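/- Let $R$ be a GCD domain, let $n\ge 0$, and let $K_n$ be the complete graph on the vertices $v_1,\dots,v_n$, with an edge labeling $\alpha$ that assigns to every edge $uv$ an element $l_{uv}\in R$. Let $$R_{(K_n,\alpha)}=\{F=(F(v_1),\dots,F(v_n))\in R^n : l_{uv}\mid F(u)-F(v)\text{ for every edge }uv\}$$ be the $R$-module of generalized splines. For $1\le i\le n$, a zero trail of $v_i$ is a walk without repeated edge that starts at $v_i$ and ends at some $v_j$ with $j<i$. Let $\mathscr L_i$ be the least common multiple, over all zero trails of $v_i$, of the greatest common divisor of the edge labels on the trail (so $\mathscr L_1=1$), and put $Q_{K_n}=\prod_{i=1}^n\mathscr L_i$ (well defined up to a unit). For $F_1,\dots,F_n\in R_{(K_n,\alpha)}$ let $|F_1\ F_2\ \cdots\ F_n|$ be the determinant of the $n\times n$ matrix whose columns are $F_1,\dots,F_n$, with rows from top to bottom the values at $v_n,\dots,v_1$. Then: (a) If $\{F_1,\dots,F_n\}$ is a basis of $R_{(K_n,\alpha)}$ over $R$, then $|F_1\ F_2\ \cdots\ F_n|=r\cdot Q_{K_n}$ for some unit $r\in R$. (b) If all edge labels are non-zero,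 then $\{F_1,\dots,F_n\}$ is a basis of $R_{(K_n,\alpha)}$ over $R$ if and only if $|F_1\ F_2\ \cdots\ F_n|=r\cdot Q_{K_n}$ for some unit $r\in R$. -/

import Mathlib

namespace GSpline

/-- The module `R_(G,α)` of generalized splines on a graph `G` with vertices
`v_1, …, v_n` (indexed by `Fin n`), where the edge `e` carries the principal ideal
generated by `α e`: vertex labelings `F` with `F u - F v ∈ (α (uv))` for every edge `uv`. -/
def splineModule {R : Type*} [CommRing R] {n : ℕ} (G : SimpleGraph (Fin n))
    (α : G.edgeSet → R) : Submodule R (Fin n → R) where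
  carrier := {F | ∀ (u v : Fin n) (h : G.Adj u v),
    F u - F v ∈ Ideal.span {α ⟨s(u, v), G.mem_edgeSet.mpr h⟩}}
  zero_mem' := by
    intro u v h
    simp
  add_mem' := by
    intro F F' hF hF' u v h
    have key := Ideal.add_mem _ (hF u v h) (hF' u v h)
    rwa [sub_add_sub_comm] at key
  smul_mem' := by
    intro c F hF u v h
    have key := Ideal.mul_mem_left _ c (hF u v h)
    rwa [mul_sub] at key

/-- The gcd of the edge labels on a walk. -/
def labelGCD {R : Type*} [CommRing R] [NormalizedGCDMonoid R] {n : ℕ}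
    {G : SimpleGraph (Fin n)} (α : G.edgeSet → R) {u v : Fin n} (p : G.Walk u v) : R :=
  (p.edges.attach.map fun e => α ⟨e.1, p.edges_subset_edgeSet e.2⟩ : Multiset R).gcd

/-- The zero trails of the vertex `i`: walks without repeated edge which start at `i` and
end at a vertex `j` of smaller index. -/
def ZeroTrail {n : ℕ} (G : SimpleGraph (Fin n)) (i : Fin n) : Type :=
  Σ j : {j : Fin n // j < i}, {p : G.Walk i j.1 // p.IsTrail}

instance finite_trail {n : ℕ} (G : SimpleGraph (Fin n)) (u v : Fin n) :
    Finite {p : G.Walk u v // p.IsTrail} := by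
  classical
  refine Set.Finite.subset
    (G.finsetWalkLengthLT (G.edgeFinset.card + 1) u v).finite_toSet ?_
  intro p hp
  rw [Finset.mem_coe, SimpleGraph.mem_finsetWalkLengthLT_iff]
  exact Nat.lt_succ_of_le hp.length_le_card_edgeFinset

instance finite_zeroTrail {n : ℕ} (G : SimpleGraph (Fin n)) (i : Fin n) :
    Finite (ZeroTrail G i) :=
  inferInstanceAs (Finite (Σ j : {j : Fin n // j < i}, {p : G.Walk i j.1 // p.IsTrail}))

noncomputable instance fintype_zeroTrail {n : ℕ} (G : SimpleGraph (Fin n)) (i : Fin n) :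
    Fintype (ZeroTrail G i) :=
  Fintype.ofFinite _

/-- The element `L_i`: the least common multiple, over all zero trails of `v_i`, of the gcd of
the edge labels on the trail. The first vertex has no zero trail, so that `L_1 = 1`. -/
noncomputable def trailLCM {R : Type*} [CommRing R] [NormalizedGCDMonoid R] {n : ℕ}
    (G : SimpleGraph (Fin n)) (α : G.edgeSet → R) (i : Fin n) : R :=
  Finset.univ.lcm fun t : ZeroTrail G i => labelGCD α t.2.1

/-- `Q_G`, the product of the `L_i`. -/
noncomputable def Q {R : Type*} [CommRing R] [NormalizedGCDMonoid R] {n : ℕ}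
    (G : SimpleGraph (Fin n)) (α : G.edgeSet → R) : R :=
  ∏ i, trailLCM G α i

/-- The spline matrix: its columns are `F_1, …, F_n`, its rows from top to bottom are
the values at `v_n, …, v_1`. -/
def splineMatrix {R : Type*} {n : ℕ} (F : Fin n → Fin n → R) : Matrix (Fin n) (Fin n) R :=
  Matrix.of fun r k => F k r.rev

/-- The family `F_1, …, F_n` of splines is a basis of the `R`-module `R_(G,α)`. -/
def FormsBasis {R : Type*} [CommRing R] {n : ℕ} {G : SimpleGraph (Fin n)} {α : G.edgeSet → R}
    (F : Fin n → splineModule G α) : Prop :=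
  ∃ b : Module.Basis (Fin n) R (splineModule G α), ⇑b = F

end GSpline

namespace GSpline

open Matrix

section GCDDomain

variable {R : Type*} [CommRing R] [NormalizedGCDMonoid R]

/-! Both parts follow from two divisibilities: `Q` divides every determinant of splines, and the
determinant of a spanning family divides `Q`. A failed divisibility survives in a localization where
divisibility is total (`exists_dvdTotal_of_not_dvd`). There a gcd of labels is attained by a single
edge, so a connectivity argument gives a spline with leading entry `L_i` at each vertex
(`exists_flowUp`). These splines form a triangular local basis of determinant `Q`, and change of
basis contradicts the failure. In (b), Cramer's rule recovers a basis from the determinant. -/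

/-- Divisibility up to factors from `S` is a total relation. -/
def DvdTotal (S : Submonoid R) : Prop :=
  ∀ a b : R, ∃ s ∈ S, a ∣ s * b ∨ b ∣ s * a

/-- In a GCD domain a failure of divisibility persists in some localization in which
divisibility is total. -/
theorem exists_dvdTotal_of_not_dvd {x y : R} (h : ¬ x ∣ y) :
    ∃ S : Submonoid R, DvdTotal S ∧ ∀ s ∈ S, ¬ x ∣ s * y := by
  obtain ⟨S, -, hS⟩ := zorn_le_nonempty₀ {S : Submonoid R | ∀ s ∈ S, ¬ x ∣ s * y}
    (fun c hc hchain S₀ hS₀ => ⟨sSup c, fun s hs => by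
      obtain ⟨T, hT, hsT⟩ :=
        (Submonoid.mem_sSup_of_directedOn ⟨S₀, hS₀⟩ hchain.directedOn).1 hs
      exact hc hT s hsT, fun T hT => le_sSup hT⟩) ⊥
    (fun s hs => by rw [Submonoid.mem_bot] at hs; simpa [hs] using h)
  -- By maximality, adjoining the powers of `a` to `S` makes the divisibility true.
  have key : ∀ a ∉ S, ∃ s ∈ S, ∃ m : ℕ, x ∣ s * a ^ m * y := by
    intro a ha
    by_contra! hcon
    refine ha (hS.2 (y := S ⊔ Submonoid.powers a) ?_ le_sup_left
      (le_sup_right (a := S) (Submonoid.mem_powers a)))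
    intro t ht
    obtain ⟨s, hs, _, ⟨m, rfl⟩, rfl⟩ := Submonoid.mem_sup.1 ht
    exact hcon s hs m
  refine ⟨S, fun a b => ?_, hS.1⟩
  obtain ⟨a', b', ha, hb, hab⟩ := extract_gcd a b
  -- Otherwise `x` divides `s * t * y` times two coprime powers, hence `s * t * y` itself.
  have hmem : a' ∈ S ∨ b' ∈ S := by
    by_contra! hcon
    obtain ⟨s, hs, k, hk⟩ := key a' hcon.1
    obtain ⟨t, ht, l, hl⟩ := key b' hcon.2
    have hrel : IsUnit (gcd (a' ^ k) (b' ^ l)) :=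
      gcd_isUnit_iff_isRelPrime.2 (gcd_isUnit_iff_isRelPrime.1 hab).pow
    have h₁ : x ∣ s * t * y * a' ^ k := hk.trans ⟨t, by ring⟩
    have h₂ : x ∣ s * t * y * b' ^ l := hl.trans ⟨s, by ring⟩
    exact hS.1 _ (S.mul_mem hs ht) (hrel.dvd_mul_right.1
      ((dvd_gcd h₁ h₂).trans (gcd_mul_left' _ _ _).dvd))
  rcases hmem with h | h
  · exact ⟨a', h, Or.inl ⟨b', by linear_combination a' * hb - b' * ha⟩⟩
  · exact ⟨b', h, Or.inr ⟨a', by linear_combination b' * ha - a' * hb⟩⟩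

/-- Under a total divisibility, a least element of `m` serves as gcd. The empty multiset has gcd `0`
and no element. -/
theorem DvdTotal.exists_mem_dvd_gcd {S : Submonoid R} (hS : DvdTotal S) {m : Multiset R}
    (hm : m ≠ 0) : ∃ a ∈ m, ∃ s ∈ S, a ∣ s * m.gcd := by
  induction m using Multiset.induction_on with
  | empty => exact absurd rfl hm
  | cons a m ih =>
    have mul_dvd : ∀ t c : R, c ∣ t * a → c ∣ t * m.gcd → c ∣ t * (a ::ₘ m).gcd := by
      intro t c h₁ h₂
      rw [Multiset.gcd_cons]
      exact (dvd_gcd h₁ h₂).trans (gcd_mul_left' t a m.gcd).dvd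
    rcases eq_or_ne m 0 with rfl | hm0
    · exact ⟨a, by simp, 1, S.one_mem, by simp⟩
    · obtain ⟨b, hb, s, hs, hbs⟩ := ih hm0
      obtain ⟨t, ht, h | h⟩ := hS a m.gcd
      · exact ⟨a, by simp, t, ht, mul_dvd t a (Dvd.intro_left t rfl) h⟩
      · refine ⟨b, by simp [hb], s * t, S.mul_mem hs ht, hbs.trans ?_⟩
        rw [mul_assoc]
        exact mul_dvd_mul_left s (mul_dvd t _ h (Dvd.intro_left t rfl))

end GCDDomain

section Spline

variable {R : Type*} [CommRing R] {n : ℕ} {G : SimpleGraph (Fin n)} {α : G.edgeSet → R}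

theorem mem_splineModule {F : Fin n → R} : F ∈ splineModule G α ↔
    ∀ (u v : Fin n) (h : G.Adj u v), α ⟨s(u, v), G.mem_edgeSet.mpr h⟩ ∣ F u - F v := by
  simp only [← Ideal.mem_span_singleton]
  rfl

theorem dvd_sub_of_forall_edges {F : Fin n → R} (hF : F ∈ splineModule G α) {g : R}
    {u v : Fin n} (p : G.Walk u v) (hp : ∀ e (he : e ∈ p.edges),
      g ∣ α ⟨e, p.edges_subset_edgeSet he⟩) : g ∣ F u - F v := by
  induction p with
  | nil => simp
  | @cons u v w h p ih =>
    rw [← sub_add_sub_cancel (F u) (F v)]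
    refine dvd_add ((hp s(u, v) (by simp)).trans (mem_splineModule.1 hF u v h)) (ih ?_)
    intro e he
    exact hp e (by simp [he])

/-- The matrix with columns `F_1, …, F_n` differs from the spline matrix by the order of
the rows. -/
theorem associated_det_splineMatrix (F : Fin n → Fin n → R) :
    Associated (splineMatrix F).det (Matrix.of F)ᵀ.det := by
  have h : splineMatrix F = (Matrix.of F)ᵀ.submatrix Fin.revPerm id := rfl
  rw [h, det_permute]
  rcases Int.units_eq_one_or (Equiv.Perm.sign (Fin.revPerm (n := n))) with h | h <;> simp [h]

variable [NormalizedGCDMonoid R]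

theorem labelGCD_dvd {u v : Fin n} (p : G.Walk u v) {e : Sym2 (Fin n)} (he : e ∈ p.edges) :
    labelGCD α p ∣ α ⟨e, p.edges_subset_edgeSet he⟩ :=
  Multiset.gcd_dvd (by
    simp only [Multiset.mem_coe, List.mem_map]
    exact ⟨⟨e, he⟩, List.mem_attach _ _, rfl⟩)

/-- Differences telescope along each zero trail, which ends at a zero of `F`. -/
theorem trailLCM_dvd {F : Fin n → R} (hF : F ∈ splineModule G α) {i : Fin n}
    (hi : ∀ j < i, F j = 0) : trailLCM G α i ∣ F i := by
  refine Finset.lcm_dvd fun t _ => ?_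
  have h := dvd_sub_of_forall_edges hF t.2.1 (fun e he => labelGCD_dvd t.2.1 he)
  rwa [hi _ t.1.2, sub_zero] at h

theorem Q_ne_zero [IsDomain R] (hα : ∀ e, α e ≠ 0) : Q G α ≠ 0 := by
  refine Finset.prod_ne_zero_iff.2 fun i _ h => ?_
  obtain ⟨t, -, ht⟩ := Finset.lcm_eq_zero_iff.1 h
  have hne : t.2.1.edges ≠ [] := by
    intro h0
    exact t.1.2.ne' (SimpleGraph.Walk.eq_of_length_eq_zero (p := t.2.1)
      (by rw [← SimpleGraph.Walk.length_edges, h0]; rfl))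
  obtain ⟨e, he⟩ := List.exists_mem_of_ne_nil _ hne
  exact hα _ (zero_dvd_iff.1 (ht ▸ labelGCD_dvd (α := α) t.2.1 he))

/-- Up to a factor from `S`, there are splines supported on the vertices from `i` on, with
value `L_i` at `v_i`. -/
theorem exists_flowUp {S : Submonoid R} (hS : DvdTotal S) (i : Fin n) :
    ∃ H ∈ splineModule G α, (∀ j < i, H j = 0) ∧ ∃ s ∈ S, H i = s * trailLCM G α i := by
  classical
  set L := trailLCM G α i with hL
  -- There are finitely many edges, so the product of their multipliers serves for all.
  have hs : ∃ s ∈ S, ∀ e, (∃ t ∈ S, α e ∣ t * L) → α e ∣ s * L := by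
    have h : ∀ e, ∃ s ∈ S, (∃ t ∈ S, α e ∣ t * L) → α e ∣ s * L := by
      intro e
      by_cases h : ∃ t ∈ S, α e ∣ t * L
      · obtain ⟨t, ht, hd⟩ := h
        exact ⟨t, ht, fun _ => hd⟩
      · exact ⟨1, S.one_mem, fun h' => absurd h' h⟩
    choose s hsS hs using h
    refine ⟨∏ e, s e, S.prod_mem fun e _ => hsS e, fun e he => (hs e he).trans ?_⟩
    exact mul_dvd_mul_right (Finset.dvd_prod_of_mem s (Finset.mem_univ e)) L
  obtain ⟨s, hsS, hs⟩ := hs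
  -- `B` is the component of `i` under edges whose labels do not divide `L` up to `S`. Edges leaving
  -- `B` do divide, so `s * L` times the indicator of `B` is a spline.
  let B : Set (Fin n) := {v | ∃ p : G.Walk i v, ∀ e (he : e ∈ p.edges),
    ∀ t ∈ S, ¬ α ⟨e, p.edges_subset_edgeSet he⟩ ∣ t * L}
  have hstep : ∀ (u v : Fin n) (h : G.Adj u v), u ∈ B → v ∉ B →
      α ⟨s(u, v), G.mem_edgeSet.mpr h⟩ ∣ s * L := by
    rintro u v h ⟨p, hp⟩ hv
    refine hs _ ?_
    by_contra! hcon
    refine hv ⟨p.concat h, fun e he => ?_⟩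
    rw [SimpleGraph.Walk.edges_concat, List.concat_eq_append, List.mem_append,
      List.mem_singleton] at he
    rcases he with he | rfl
    · exact hp e he
    · exact hcon
  -- A path inside `B` to such a `j` is a zero trail. Its gcd divides `L`, and one of its labels
  -- divides that gcd up to `S`.
  have hlow : ∀ j < i, j ∉ B := by
    rintro j hj ⟨p, hp⟩
    have hsub := p.edges_toPath_subset_edges
    have hd : labelGCD α (p.toPath : G.Walk i j) ∣ L :=
      Finset.dvd_lcm (f := fun t : ZeroTrail G i => labelGCD α t.2.1)
        (b := ⟨⟨j, hj⟩, ⟨p.toPath, p.toPath.2.isTrail⟩⟩) (Finset.mem_univ _)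
    obtain ⟨a, ha, t, ht, hat⟩ := hS.exists_mem_dvd_gcd
      (m := ((p.toPath : G.Walk i j).edges.attach.map fun e => α ⟨e.1, (p.toPath : G.Walk i j).edges_subset_edgeSet e.2⟩ : Multiset R)) (by
        intro h0
        have := congrArg Multiset.card h0
        simp only [Multiset.coe_card, List.length_map, List.length_attach,
          SimpleGraph.Walk.length_edges, Multiset.card_zero] at this
        exact hj.ne' (SimpleGraph.Walk.eq_of_length_eq_zero this))
    simp only [Multiset.mem_coe, List.mem_map] at ha
    obtain ⟨⟨e, he⟩, -, rfl⟩ := ha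
    exact hp e (hsub he) t ht (hat.trans (mul_dvd_mul_left t hd))
  have hiB : i ∈ B := ⟨.nil, by simp⟩
  refine ⟨fun v => if v ∈ B then s * L else 0, mem_splineModule.2 fun u v h => ?_,
    fun j hj => if_neg (hlow j hj), s, hsS, if_pos hiB⟩
  by_cases hu : u ∈ B <;> by_cases hv : v ∈ B
  · simp [hu, hv]
  · simpa [hu, hv] using hstep u v h hu hv
  · have := hstep v u h.symm hv hu
    simp only [hu, hv, if_true, if_false, zero_sub, dvd_neg]
    simpa only [Sym2.eq_swap (a := v)] using this
  · simp [hu, hv]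

/-- A triangular family of splines whose determinant is `Q` up to a factor from `S`, and which
generates all splines up to factors from `S`. -/
theorem exists_triangular {S : Submonoid R} (hS : DvdTotal S) :
    ∃ H : Fin n → Fin n → R, (∀ i, H i ∈ splineModule G α) ∧
      (∃ s ∈ S, (Matrix.of H).det = s * Q G α) ∧
      ∀ F ∈ splineModule G α, ∃ t ∈ S, ∃ c : Fin n → R, t • F = ∑ i, c i • H i := by
  choose H hH hlow s hsS hs using fun i => exists_flowUp (G := G) (α := α) hS i
  refine ⟨H, hH, ⟨∏ i, s i, S.prod_mem fun i _ => hsS i, ?_⟩, ?_⟩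
  · rw [det_of_isUpperTriangular (M := Matrix.of H) (fun i j hij => hlow i j hij), Q, ← Finset.prod_mul_distrib]
    exact Finset.prod_congr rfl fun i _ => hs i
  -- Gaussian elimination: each round clears the first possibly nonzero entry, and `k` counts the
  -- entries left.
  · have key : ∀ k m : ℕ, m + k = n → ∀ F ∈ splineModule G α, (∀ j : Fin n, j.1 < m → F j = 0) →
        ∃ t ∈ S, ∃ c : Fin n → R, t • F = ∑ i, c i • H i := by
      intro k
      induction k with
      | zero =>
        intro m hm F _ hF
        have : F = 0 := funext fun j => hF j (by omega)
        exact ⟨1, S.one_mem, 0, by simp [this]⟩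
      | succ k ih =>
        intro m hm F hF h0
        let i : Fin n := ⟨m, by omega⟩
        obtain ⟨q, hq⟩ := trailLCM_dvd hF (i := i) (fun j hj => h0 j hj)
        obtain ⟨t, ht, c, hc⟩ := ih (m + 1) (by omega) (s i • F - q • H i)
          (Submodule.sub_mem _ (Submodule.smul_mem _ _ hF) (Submodule.smul_mem _ _ (hH i)))
          (by
            intro j hj
            rcases Nat.lt_succ_iff_lt_or_eq.1 hj with hj | hj
            · simp [h0 j hj, hlow i j hj]
            · obtain rfl : j = i := Fin.ext hj
              simp only [Pi.sub_apply, Pi.smul_apply, smul_eq_mul, hs, hq]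
              ring)
        refine ⟨t * s i, S.mul_mem ht (hsS i), c + Pi.single i (t * q), ?_⟩
        simp only [Pi.add_apply, add_smul, Finset.sum_add_distrib, ← hc]
        rw [Finset.sum_eq_single i (fun j _ hj => by simp [hj]) (by simp), Pi.single_eq_same,
          smul_sub, mul_smul, mul_smul, sub_add_cancel]
    exact fun F hF => key n 0 (zero_add n) F hF (by simp)

theorem Q_dvd_det {F : Fin n → Fin n → R} (hF : ∀ i, F i ∈ splineModule G α) :
    Q G α ∣ (Matrix.of F).det := by
  by_contra h
  obtain ⟨S, hS, hS'⟩ := exists_dvdTotal_of_not_dvd h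
  obtain ⟨H, -, ⟨s, -, hs⟩, hspan⟩ := exists_triangular (G := G) (α := α) hS
  choose t ht c hc using fun i => hspan (F i) (hF i)
  refine hS' (∏ i, t i) (S.prod_mem fun i _ => ht i) ?_
  have hmul : Matrix.of (fun i => t i • F i) = Matrix.of c * Matrix.of H := by
    ext i j
    simp [hc, Matrix.mul_apply, Finset.sum_apply]
  have hdet := det_mul_column t (Matrix.of F)
  rw [← hdet]
  have h2 : (Matrix.of fun i j => t i * Matrix.of F i j) = Matrix.of c * Matrix.of H := hmul
  rw [h2, det_mul, hs]
  exact Dvd.intro_left ((Matrix.of c).det * s) (by ring)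

theorem det_dvd_Q {F : Fin n → Fin n → R}
    (hF : ∀ H ∈ splineModule G α, ∃ c : Fin n → R, H = ∑ i, c i • F i) :
    (Matrix.of F).det ∣ Q G α := by
  by_contra h
  obtain ⟨S, hS, hS'⟩ := exists_dvdTotal_of_not_dvd h
  obtain ⟨H, hH, ⟨s, hsS, hs⟩, -⟩ := exists_triangular (G := G) (α := α) hS
  choose c hc using fun i => hF (H i) (hH i)
  refine hS' s hsS ?_
  have hmul : Matrix.of H = Matrix.of c * Matrix.of F := by
    ext i j
    simp [hc, Matrix.mul_apply, Finset.sum_apply]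
  rw [← hs, hmul, det_mul]
  exact Dvd.intro_left _ rfl

theorem FormsBasis.associated_det {F : Fin n → splineModule G α} (h : FormsBasis F) :
    Associated (Matrix.of fun k => (F k : Fin n → R)).det (Q G α) := by
  obtain ⟨b, rfl⟩ := h
  refine associated_of_dvd_dvd (det_dvd_Q fun H hH => ?_) (Q_dvd_det fun i => (b i).2)
  refine ⟨b.repr ⟨H, hH⟩, ?_⟩
  simpa only [Submodule.coe_sum, Submodule.coe_smul] using
    congrArg Subtype.val (b.sum_repr ⟨H, hH⟩).symm

theorem formsBasis_of_associated_det [IsDomain R] (hα : ∀ e, α e ≠ 0) {F : Fin n → splineModule G α}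
    (h : Associated (Matrix.of fun k => (F k : Fin n → R)).det (Q G α)) : FormsBasis F := by
  set M := Matrix.of fun k => (F k : Fin n → R) with hM
  have hdet : M.det ≠ 0 := h.ne_zero_iff.2 (Q_ne_zero hα)
  have hli : LinearIndependent R F := by
    refine LinearIndependent.of_comp (splineModule G α).subtype ?_
    exact linearIndependent_rows_of_det_ne_zero hdet
  have hspan : ⊤ ≤ Submodule.span R (Set.range F) := by
    rintro ⟨H, hH⟩ -
    -- These are the Cramer numerators of the coordinates of `H`. All rows are splines, so `Q`, and
    -- with it `M.det`, divides them.
    have hd : ∀ k, M.det ∣ (M.updateRow k H).det := by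
      intro k
      refine h.dvd.trans (Q_dvd_det (F := M.updateRow k H) fun i => ?_)
      rcases eq_or_ne i k with rfl | hik
      · simpa using hH
      · rw [updateRow_ne hik]
        exact (F i).2
    choose c hc using hd
    have hsum : H = ∑ k, c k • (F k : Fin n → R) := by
      have hcr := mulVec_cramer Mᵀ H
      rw [det_transpose] at hcr
      funext j
      have hj := congrFun hcr j
      simp only [mulVec, dotProduct, transpose_apply, cramer_transpose_apply, hc,
        Pi.smul_apply, smul_eq_mul] at hj
      refine mul_left_cancel₀ hdet (hj.symm.trans ?_)
      simp only [Finset.sum_apply, Pi.smul_apply, smul_eq_mul, Finset.mul_sum]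
      exact Finset.sum_congr rfl fun k _ => by simp only [hM, of_apply]; ring
    have : (⟨H, hH⟩ : splineModule G α) = ∑ k, c k • F k := Subtype.ext (by simpa using hsum)
    rw [this]
    exact Submodule.sum_mem _ fun k _ => Submodule.smul_mem _ _ (Submodule.subset_span ⟨k, rfl⟩)
  exact ⟨Module.Basis.mk hli hspan, Module.Basis.coe_mk hli hspan⟩

theorem associated_det_splineMatrix_iff (F : Fin n → Fin n → R) :
    Associated (Matrix.of F).det (Q G α) ↔
      ∃ r : R, IsUnit r ∧ (splineMatrix F).det = r * Q G α := by
  have hs := associated_det_splineMatrix F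
  rw [det_transpose] at hs
  constructor
  · intro h
    obtain ⟨u, hu⟩ := (hs.trans h).symm
    exact ⟨u, u.isUnit, by rw [← hu, mul_comm]⟩
  · rintro ⟨r, hr, h⟩
    refine hs.symm.trans (Associated.symm ⟨hr.unit, ?_⟩)
    rw [h, IsUnit.unit_spec, mul_comm]

end Spline

end GSpline

theorem mainTheorem2 {R : Type*} [CommRing R] [IsDomain R] [NormalizedGCDMonoid R] (n : ℕ)
    (α : (SimpleGraph.completeGraph (Fin n)).edgeSet → R)
    (F : Fin n → GSpline.splineModule (SimpleGraph.completeGraph (Fin n)) α) :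
    (GSpline.FormsBasis F →
      ∃ r : R, IsUnit r ∧
        (GSpline.splineMatrix fun k => (F k : Fin n → R)).det =
          r * GSpline.Q (SimpleGraph.completeGraph (Fin n)) α) ∧
    ((∀ e, α e ≠ 0) →
      (GSpline.FormsBasis F ↔
        ∃ r : R, IsUnit r ∧
          (GSpline.splineMatrix fun k => (F k : Fin n → R)).det =
            r * GSpline.Q (SimpleGraph.completeGraph (Fin n)) α)) :=
  ⟨fun h => (GSpline.associated_det_splineMatrix_iff _).1 h.associated_det,
    fun hα => ⟨fun h => (GSpline.associated_det_splineMatrix_iff _).1 h.associated_det,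
      fun h => GSpline.formsBasis_of_associated_det hα
        ((GSpline.associated_det_splineMatrix_iff _).2 h)⟩⟩
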